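/- Let $S$ be a Noetherian commutative ring and let $J\subset S$ be an ideal such that the quotient ring $S/J$ is Artinian. An $S$-module $M$ is called \emph{$J$-torsion} if for every $s\in J$ and every $m\in M$ there is an integer $n\ge 1$ with $s^n m=0$. Complexes are cohomologically graded and indexed by $\mathbb{Z}$; a complex is \emph{finite} if its terms are zero outside a bounded range of degrees, and \emph{bounded above} if its terms are zero in all sufficiently large degrees. Let $N^\bullet$ be a finite complex of $J$-torsion $S$-modules. Then the following two conditions are equivalent: (1) all the cohomology $S$-modules $H^i(N^\bullet)$, $i\in\mathbb{Z}$, are Artinian; (2) for every finite complex $K^\bullet$ of finitely generated projective $S$-modules whose cohomology modules are $J$-torsion, the complex of $S$-modules $\operatorname{Hom}_S(K^\bullet,N^\bullet)$ is quasi-isomorphic to a bounded above complex of finitely generated projective $S$-modules. -/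

import Mathlib

open CategoryTheory

universe u

namespace TorsionComplex

/-- An `S`-module `M` is `J`-torsion if every element of `M` is annihilated by some positive
power of each `s ∈ J`. -/
def IsIdealTorsion {S : Type u} [CommRing S] (J : Ideal S)
    (M : Type u) [AddCommGroup M] [Module S M] : Prop :=
  ∀ s ∈ J, ∀ m : M, ∃ n : ℕ, 1 ≤ n ∧ s ^ n • m = 0

/-- A finite complex: its terms vanish outside a bounded range of degrees. -/
def IsFiniteComplex {S : Type u} [CommRing S] (K : CochainComplex (ModuleCat.{u} S) ℤ) : Prop :=
  ∃ a b : ℤ, K.IsStrictlyGE a ∧ K.IsStrictlyLE b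

/-- A bounded above complex: its terms vanish in all large cohomological degrees. -/
def IsBoundedAbove {S : Type u} [CommRing S] (K : CochainComplex (ModuleCat.{u} S) ℤ) : Prop :=
  ∃ b : ℤ, K.IsStrictlyLE b

/-- A complex whose terms are finitely generated projective modules. -/
def IsTermwiseFGProjective {S : Type u} [CommRing S]
    (K : CochainComplex (ModuleCat.{u} S) ℤ) : Prop :=
  ∀ i : ℤ, Module.Finite S (K.X i) ∧ Module.Projective S (K.X i)

/-- Two complexes are quasi-isomorphic if they are connected by a finite zigzag of
quasi-isomorphisms of complexes of `S`-modules. -/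
def IsQuasiIsomorphic {S : Type u} [CommRing S]
    (K L : CochainComplex (ModuleCat.{u} S) ℤ) : Prop :=
  Relation.EqvGen (fun A B : CochainComplex (ModuleCat.{u} S) ℤ => ∃ f : A ⟶ B, QuasiIso f) K L

/-- The complex of `S`-modules `Hom_S(K, N)`. In degree `n` it is the `S`-module of all families of
`S`-linear maps `K.X p → N.X q` with `p + n = q`, and the differential of such a family `z` is
`d ∘ z + (-1)^(n+1) z ∘ d`, that is, `d ∘ z - (-1)^n z ∘ d`. -/
noncomputable def homComplex {S : Type u} [CommRing S]
    (K N : CochainComplex (ModuleCat.{u} S) ℤ) : CochainComplex (ModuleCat.{u} S) ℤ where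
  X n := ModuleCat.of S (CochainComplex.HomComplex.Cochain K N n)
  d n m := ModuleCat.ofHom (CochainComplex.HomComplex.δ_hom S K N n m)
  shape n m h := by
    ext z : 2
    exact CochainComplex.HomComplex.δ_shape n m h z
  d_comp_d' n m k _ _ := by
    ext z : 2
    exact CochainComplex.HomComplex.δ_δ n m k z

end TorsionComplex

/-! Condition (2) amounts to finite generation of the cohomology of `homComplex K N`: this complex
is bounded above, and over a Noetherian ring a bounded above complex with finitely generated
cohomology has a resolution by finitely generated projectives (`exists_fgProjective_resolution`).
For modules killed by a power of `J`, Artinian implies Noetherian, and for those killed by `J`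
itself the two notions agree, because `S ⧸ J` is Artinian.

(1) ⇒ (2): filtering cocycles by the degrees of `K` on which they vanish reduces the cohomology of
`homComplex K N` to the Artinian modules `Hom(K^p, H^{p+n}(N))` (`isArtinian_homology_homComplex`).
The same filtration on endomorphisms of `K` shows that multiplication by elements of some `J ^ k` is
null-homotopic on `K`, so `J ^ k` kills that cohomology.

(2) ⇒ (1): one test complex suffices, the Koszul complex on generators of `J`, built by iterated
cones of multiplications on `S` in degree 0 (`exists_koszul`). Its Hom into `N` has finitely
generated cohomology killed by `J`, hence Artinian. The cones are undone one at a time: the kernel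
of `s` on the cohomology before a cone is a quotient of the cohomology after it, and an `s`-torsion
module whose `s`-kernel is Artinian is Artinian (`isArtinian_of_ker_smul`). -/

namespace TorsionComplex

/-! ### Artinian modules, torsion, and comparison with Noetherian modules. -/

section Modules

variable {S : Type*} [CommRing S]

/-- If `M → A` has Artinian target and the image in `Q` of its kernel lies in an Artinian
submodule, then the quotient `Q` of `M` is Artinian. -/
theorem isArtinian_of_surjective_of_map_ker_le {M A Q : Type*}
    [AddCommGroup M] [AddCommGroup A] [AddCommGroup Q] [Module S M] [Module S A] [Module S Q]
    [IsArtinian S A] (f : M →ₗ[S] A) (g : M →ₗ[S] Q) (hg : Function.Surjective g)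
    (P : Submodule S Q) [IsArtinian S P] (hP : (LinearMap.ker f).map g ≤ P) :
    IsArtinian S Q := by
  have h1 : IsArtinian S (M ⧸ LinearMap.ker f) :=
    isArtinian_of_injective ((LinearMap.ker f).liftQ f le_rfl)
      (LinearMap.ker_eq_bot.1 (Submodule.ker_liftQ_eq_bot _ _ _ le_rfl))
  have h2 : IsArtinian S (Q ⧸ P) := by
    refine isArtinian_of_surjective (M ⧸ LinearMap.ker f)
      ((LinearMap.ker f).mapQ P g (Submodule.map_le_iff_le_comap.1 hP)) ?_
    intro y
    obtain ⟨q, rfl⟩ := P.mkQ_surjective y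
    obtain ⟨m, rfl⟩ := hg q
    exact ⟨(LinearMap.ker f).mkQ m, rfl⟩
  exact (isArtinian_iff_submodule_quotient P).2 ⟨inferInstance, h2⟩

theorem isArtinian_linearMap {M A : Type*} [AddCommGroup M] [AddCommGroup A] [Module S M]
    [Module S A] [Module.Finite S M] [IsArtinian S A] : IsArtinian S (M →ₗ[S] A) := by
  obtain ⟨n, s, hs⟩ := Module.Finite.exists_fin (R := S) (M := M)
  refine isArtinian_of_injective
    (LinearMap.pi fun i => LinearMap.applyₗ (s i) : (M →ₗ[S] A) →ₗ[S] (Fin n → A)) ?_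
  intro f g hfg
  refine LinearMap.ext_on_range hs fun i => ?_
  exact congrFun hfg i

/-- A module on which `s` acts locally nilpotently is Artinian as soon as the kernel of
multiplication by `s` is. -/
theorem isArtinian_of_ker_smul {M : Type*} [AddCommGroup M] [Module S M] (s : S)
    (htors : ∀ m : M, ∃ n : ℕ, s ^ n • m = 0) (K : Submodule S M) [IsArtinian S K]
    (hK : ∀ m : M, s • m = 0 → m ∈ K) : IsArtinian S M := by
  rw [← monotone_stabilizes_iff_artinian]
  intro A
  let B : ℕ → Submodule S M := fun k => A k
  -- `D n k` consists of the elements of `K` of the form `s ^ n • y` with `y ∈ A k`.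
  let D : ℕ → ℕ → Submodule S K := fun n k =>
    ((B k).map (LinearMap.lsmul S M (s ^ n))).comap K.subtype
  have hmono : ∀ n n' k k', n ≤ n' → k ≤ k' → D n' k' ≤ D n k := by
    rintro n n' k k' hn hk ⟨x, hx⟩ ⟨y, hy, hxy⟩
    refine ⟨s ^ (n' - n) • y, (B k).smul_mem _ (A.monotone hk hy), ?_⟩
    simp only [LinearMap.lsmul_apply, Submodule.subtype_apply] at hxy ⊢
    rw [smul_smul, ← pow_add, Nat.add_sub_cancel' hn, hxy]
  -- Stability on the diagonal from `m` on makes `D n k` constant for all `n, k ≥ m`; only the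
  -- finitely many rows `n < m` then need separate bounds.
  have hdiag : ∃ m, ∀ n ≥ m, D m m = D n n := by
    obtain ⟨m, hm⟩ := IsArtinian.monotone_stabilizes
      (⟨fun n => D n n, fun a b h => hmono a b a b h h⟩ : ℕ →o (Submodule S K)ᵒᵈ)
    exact ⟨m, hm⟩
  obtain ⟨m, hm⟩ := hdiag
  have hrow : ∀ n, ∃ k, ∀ l ≥ k, D n k = D n l := by
    intro n
    obtain ⟨k, hk⟩ := IsArtinian.monotone_stabilizes
      (⟨fun k => D n k, fun a b h => hmono n n a b le_rfl h⟩ : ℕ →o (Submodule S K)ᵒᵈ)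
    exact ⟨k, hk⟩
  choose k hk using hrow
  let k1 := max m ((Finset.range m).sup k)
  have hstab : ∀ n, ∀ l ≥ k1, D n k1 ≤ D n l := by
    intro n l hl
    by_cases hn : n < m
    · have h1 : k n ≤ k1 := le_max_of_le_right (Finset.le_sup (Finset.mem_range.2 hn))
      rw [← hk n k1 h1, ← hk n l (h1.trans hl)]
    · push Not at hn
      have h1 : D n k1 ≤ D m m := hmono m n m k1 hn (le_max_left _ _)
      have h2 : D m m ≤ D n l := by
        rw [hm (max n l) (hn.trans (le_max_left _ _))]
        exact hmono n _ l _ (le_max_left _ _) (le_max_right _ _)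
      exact h1.trans h2
  refine ⟨k1, fun l hl => ?_⟩
  have hmonoA : ∀ x, x ∈ B l → x ∈ B k1 := fun x hx => A.monotone hl hx
  -- Successive approximation: `s ^ n • x` agrees with some `s ^ n • y`, `y ∈ B l`, and the error `x
  -- - y` is killed by a smaller power of `s`.
  have key : ∀ n, ∀ x ∈ B k1, s ^ n • x = 0 → x ∈ B l := by
    intro n
    induction n with
    | zero => intro x _ h; simp only [pow_zero, one_smul] at h; rw [h]; exact Submodule.zero_mem _
    | succ n ih =>
      intro x hx h
      have h1 : s ^ n • x ∈ K := hK _ (by rw [smul_smul, ← pow_succ', h])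
      have h2 : (⟨s ^ n • x, h1⟩ : K) ∈ D n k1 := ⟨x, hx, rfl⟩
      obtain ⟨y, hy, hxy⟩ := hstab n l hl h2
      simp only [LinearMap.lsmul_apply, Submodule.subtype_apply] at hxy
      have hy' : y ∈ B k1 := hmonoA y hy
      have h3 := ih (x - y) (Submodule.sub_mem _ hx hy') (by rw [smul_sub, hxy, sub_self])
      simpa using Submodule.add_mem _ h3 hy
  refine Submodule.ext (p := B k1) (q := B l) fun x => ⟨fun hx => ?_, hmonoA x⟩
  obtain ⟨n, hn⟩ := htors x
  exact key n x hx hn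

/-- The submodules over `S` and over `S ⧸ J` are the same, and over an Artinian ring the two chain
conditions coincide. -/
theorem isArtinian_iff_isNoetherian_of_smul_eq_zero {M : Type*} [AddCommGroup M] [Module S M]
    (J : Ideal S) [IsArtinianRing (S ⧸ J)] (h : ∀ s ∈ J, ∀ m : M, s • m = 0) :
    IsArtinian S M ↔ IsNoetherian S M := by
  have hM : Module.IsTorsionBySet S M J := fun m s => h s s.2 m
  let _ := hM.module
  have : IsScalarTower S (S ⧸ J) M := hM.isScalarTower
  have hs : Function.Surjective (algebraMap S (S ⧸ J)) := Ideal.Quotient.mk_surjective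
  let e : Submodule (S ⧸ J) M ≃o Submodule S M := Submodule.orderIsoOfAlgebraMapSurjective hs
  have hA : IsArtinian (S ⧸ J) M ↔ IsArtinian S M :=
    ⟨fun _ => e.symm.toOrderEmbedding.wellFoundedLT, fun _ => e.toOrderEmbedding.wellFoundedLT⟩
  have hN : IsNoetherian (S ⧸ J) M ↔ IsNoetherian S M := by
    rw [isNoetherian_iff', isNoetherian_iff']
    exact ⟨fun _ => e.symm.toOrderEmbedding.wellFoundedGT,
      fun _ => e.toOrderEmbedding.wellFoundedGT⟩
  rw [← hA, ← hN, IsSemiprimaryRing.isNoetherian_iff_isArtinian]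

/-- Induction along `J M ⊆ M`: the quotient is killed by `J` and the submodule by one power of `J`
fewer. -/
theorem isNoetherian_of_isArtinian_of_pow_smul_eq_zero (J : Ideal S) [IsArtinianRing (S ⧸ J)]
    (k : ℕ) : ∀ {M : Type u} [AddCommGroup M] [Module S M] [IsArtinian S M],
      (∀ s ∈ J ^ k, ∀ m : M, s • m = 0) → IsNoetherian S M := by
  induction k with
  | zero =>
    intro M _ _ _ h
    have : Subsingleton M := ⟨fun a b => by
      rw [← one_smul S a, ← one_smul S b, h 1 (by simp) a, h 1 (by simp) b]⟩
    infer_instance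
  | succ k ih =>
    intro M _ _ _ h
    have h1 : IsNoetherian S (J • (⊤ : Submodule S M) : Submodule S M) := by
      refine ih fun s hs m => Subtype.ext ?_
      have : (m : M) ∈ J • (⊤ : Submodule S M) := m.2
      change s • (m : M) = 0
      refine Submodule.smul_induction_on this ?_ ?_
      · intro r hr x _
        rw [smul_smul]
        exact h _ (by rw [pow_succ]; exact Ideal.mul_mem_mul hs hr) _
      · intro x y hx hy
        rw [smul_add, hx, hy, add_zero]
    have h2 : IsNoetherian S (M ⧸ (J • (⊤ : Submodule S M) : Submodule S M)) := by
      refine (isArtinian_iff_isNoetherian_of_smul_eq_zero J ?_).1 inferInstance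
      intro s hs m
      obtain ⟨m, rfl⟩ := Submodule.mkQ_surjective _ m
      rw [← map_smul, Submodule.mkQ_apply, Submodule.Quotient.mk_eq_zero]
      exact Submodule.smul_mem_smul hs trivial
    exact (isNoetherian_iff_submodule_quotient _).2 ⟨h1, h2⟩

end Modules

/-! ### Homology classes in terms of elements. -/

section Homology

variable {S : Type u} [CommRing S]

/-- The class in homology of a cycle. -/
noncomputable def kerToHomology (T : ShortComplex (ModuleCat.{u} S)) :
    LinearMap.ker T.g.hom →ₗ[S] T.homology :=
  (T.moduleCatCyclesIso.inv ≫ T.homologyπ).hom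

theorem kerToHomology_surjective (T : ShortComplex (ModuleCat.{u} S)) :
    Function.Surjective (kerToHomology T) :=
  (ModuleCat.epi_iff_surjective (T.moduleCatCyclesIso.inv ≫ T.homologyπ)).1 inferInstance

theorem kerToHomology_eq_zero_iff (T : ShortComplex (ModuleCat.{u} S))
    (z : LinearMap.ker T.g.hom) : kerToHomology T z = 0 ↔ ∃ y, T.f.hom y = z := by
  rw [kerToHomology, ShortComplex.moduleCatCyclesIso_inv_π]
  let e : T.homology ≃ₗ[S] (LinearMap.ker T.g.hom ⧸ LinearMap.range T.moduleCatToCycles) :=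
    T.moduleCatHomologyIso.toLinearEquiv
  change e.symm (Submodule.mkQ (LinearMap.range T.moduleCatToCycles) z) = 0 ↔ _
  rw [LinearEquiv.map_eq_zero_iff]
  refine (Submodule.Quotient.mk_eq_zero _).trans ⟨?_, ?_⟩
  · rintro ⟨y, hy⟩
    exact ⟨y, congrArg Subtype.val hy⟩
  · rintro ⟨y, hy⟩
    exact ⟨y, Subtype.ext hy⟩

/-- The projection from cycles to homology, on the level of elements. -/
theorem exists_cycles_to_homology {ι : Type*} {c : ComplexShape ι}
    (C : HomologicalComplex (ModuleCat.{u} S) c) (i j k : ι) (hi : c.prev j = i)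
    (hk : c.next j = k) :
    ∃ π : LinearMap.ker (C.d j k).hom →ₗ[S] C.homology j,
      Function.Surjective π ∧ ∀ z, π z = 0 ↔ ∃ y, (C.d i j).hom y = z := by
  subst hi hk
  exact ⟨kerToHomology (C.sc j), kerToHomology_surjective _, kerToHomology_eq_zero_iff (C.sc j)⟩

end Homology

open CochainComplex.HomComplex

/-! ### Filtration of Hom cocycles by the degree in the source. -/

section Filtration

variable {S : Type u} [CommRing S] {K L : CochainComplex (ModuleCat.{u} S) ℤ}

/-- Cocycles of degree `n` in `Hom(K, L)` that vanish on the terms of degree `> p` of `K`. -/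
def cocyclesVanishingAbove (K L : CochainComplex (ModuleCat.{u} S) ℤ) (n p : ℤ) :
    Submodule S (Cochain K L n) where
  carrier := {z | δ n (n + 1) z = 0 ∧ ∀ i j (h : i + n = j), p < i → z.v i j h = 0}
  add_mem' := by
    rintro a b ⟨ha, ha'⟩ ⟨hb, hb'⟩
    refine ⟨by rw [δ_add, ha, hb, add_zero], fun i j h hi => ?_⟩
    rw [Cochain.add_v, ha' i j h hi, hb' i j h hi, add_zero]
  zero_mem' := ⟨δ_zero _ _, fun _ _ _ _ => rfl⟩
  smul_mem' := by
    rintro s a ⟨ha, ha'⟩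
    refine ⟨by rw [δ_smul, ha, smul_zero], fun i j h hi => ?_⟩
    rw [Cochain.smul_v, ha' i j h hi, smul_zero]

/-- The value in the top degree `p` of a cocycle vanishing above `p` consists of cycles. -/
theorem d_v_eq_zero {n p : ℤ} {z : Cochain K L n} (hz : z ∈ cocyclesVanishingAbove K L n p)
    (q q' : ℤ) (hq : p + n = q) (hq' : q + 1 = q') : z.v p q hq ≫ L.d q q' = 0 := by
  have h := Cochain.congr_v hz.1 p q' (by lia)
  rw [δ_v n (n + 1) rfl z p q' (by lia) q (p + 1) (by lia) rfl,
    hz.2 (p + 1) q' (by lia) (by lia)] at h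
  simpa using h

/-- A cocycle vanishing above `p` whose values in degree `p` are boundaries is cohomologous to
one that vanishes above `p - 1`. -/
theorem exists_sub_δ_mem {n p : ℤ} {z : Cochain K L n} (hP : Module.Projective S (K.X p))
    (hz : z ∈ cocyclesVanishingAbove K L n p) (q' q : ℤ) (hq : p + n = q) (hq' : q' + 1 = q)
    (h : ∀ x, ∃ y, (L.d q' q).hom y = (z.v p q hq).hom x) :
    ∃ w : Cochain K L (n - 1), z - δ (n - 1) n w ∈ cocyclesVanishingAbove K L n (p - 1) := by
  obtain ⟨g, hg⟩ : ∃ g : K.X p →ₗ[S] L.X q', (L.d q' q).hom.comp g = (z.v p q hq).hom := by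
    let D := (L.d q' q).hom
    have hr : ∀ x, (z.v p q hq).hom x ∈ LinearMap.range D := fun x => by
      obtain ⟨y, hy⟩ := h x
      exact ⟨y, hy⟩
    obtain ⟨g, hg⟩ := Module.projective_lifting_property D.rangeRestrict
      ((z.v p q hq).hom.codRestrict _ hr) D.surjective_rangeRestrict
    refine ⟨g, LinearMap.ext fun x => ?_⟩
    exact congrArg Subtype.val (LinearMap.congr_fun hg x)
  have hg' : ModuleCat.ofHom g ≫ L.d q' q = z.v p q hq := by
    ext x
    exact LinearMap.congr_fun hg x
  -- The coboundary of `w` lives only in source degrees `p` and `p - 1`; it cancels `z` in degree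
  -- `p`, and degree `p - 1` is unconstrained.
  let w : Cochain K L (n - 1) := Cochain.single (ModuleCat.ofHom g) (n - 1)
  refine ⟨w, ?_, fun i j hij hi => ?_⟩
  · rw [δ_sub, hz.1, δ_δ, sub_zero]
  · have h1 : w.v (i + 1) j (by lia) = 0 := Cochain.single_v_eq_zero _ _ _ _ _ (by lia)
    rw [Cochain.sub_v, δ_v (n - 1) n (by lia) w i j hij (j - 1) (i + 1) rfl rfl, h1,
      Limits.comp_zero, smul_zero, add_zero]
    by_cases hip : i = p
    · subst hip
      obtain rfl : j = q := by lia
      obtain rfl : q' = j - 1 := by lia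
      rw [show w.v i (j - 1) (by lia) = ModuleCat.ofHom g from Cochain.single_v _ _ _, hg', sub_self]
    · rw [hz.2 i j hij (by lia),
        show w.v i (j - 1) (by lia) = 0 from Cochain.single_v_eq_zero _ _ _ _ _ hip]
      simp

theorem cocyclesVanishingAbove_eq_bot {n p : ℤ} [K.IsStrictlyGE (p + 1)] :
    cocyclesVanishingAbove K L n p = ⊥ := by
  rw [eq_bot_iff]
  rintro z ⟨_, hz⟩
  refine Cochain.ext _ _ fun i j h => ?_
  by_cases hi : p < i
  · rw [hz i j h hi, Cochain.zero_v]
  · exact (K.isZero_of_isStrictlyGE (p + 1) i (by lia)).eq_of_src _ _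

theorem mem_cocyclesVanishingAbove_of_isStrictlyLE {n p : ℤ} [K.IsStrictlyLE p]
    {z : Cochain K L n} (hz : δ n (n + 1) z = 0) : z ∈ cocyclesVanishingAbove K L n p :=
  ⟨hz, fun i _ _ hi => (K.isZero_of_isStrictlyLE p i hi).eq_of_src _ _⟩

/-- Coboundaries of degree `n`. -/
abbrev coboundaries (K L : CochainComplex (ModuleCat.{u} S) ℤ) (n : ℤ) :
    Submodule S (Cochain K L n) := LinearMap.range (δ_hom S K L (n - 1) n)

/-- The component in degree `p` takes values in cycles, giving a map to the Artinian module
`Hom(K^p, H^{p+n}(L))`. On its kernel that component consists of boundaries, so projectivity of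
`K^p` moves the cocycle one filtration step down. -/
theorem isArtinian_map_cocyclesVanishingAbove_succ (n p : ℤ) (hF : Module.Finite S (K.X p))
    (hP : Module.Projective S (K.X p)) (hL : IsArtinian S (L.homology (p + n)))
    (h : IsArtinian S ((cocyclesVanishingAbove K L n (p - 1)).map (coboundaries K L n).mkQ)) :
    IsArtinian S ((cocyclesVanishingAbove K L n p).map (coboundaries K L n).mkQ) := by
  obtain ⟨π, hπ, hπ0⟩ := exists_cycles_to_homology L (p + n - 1) (p + n) (p + n + 1)
    (by simp) (by simp)
  let c (z : cocyclesVanishingAbove K L n p) : K.X p →ₗ[S] LinearMap.ker (L.d (p + n) (p + n + 1)).hom :=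
    (z.1.v p (p + n) rfl).hom.codRestrict _ fun x => by
      have := d_v_eq_zero z.2 (p + n) (p + n + 1) rfl rfl
      exact LinearMap.congr_fun (congrArg ModuleCat.Hom.hom this) x
  let f : cocyclesVanishingAbove K L n p →ₗ[S] (K.X p →ₗ[S] L.homology (p + n)) :=
    { toFun := fun z => π.comp (c z)
      map_add' := fun a b => by
        ext x
        exact (congrArg π (Subtype.ext rfl)).trans (map_add π (c a x) (c b x))
      map_smul' := fun s a => by
        ext x
        exact (congrArg π (Subtype.ext rfl)).trans (map_smul π s (c a x)) }
  have : IsArtinian S (K.X p →ₗ[S] L.homology (p + n)) := isArtinian_linearMap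
  let Q := (cocyclesVanishingAbove K L n p).map (coboundaries K L n).mkQ
  let P := (cocyclesVanishingAbove K L n (p - 1)).map (coboundaries K L n).mkQ
  have hPA : IsArtinian S (P.comap Q.subtype) :=
    isArtinian_of_injective (LinearMap.restrict Q.subtype (fun x hx => hx) : P.comap Q.subtype →ₗ[S] P)
      fun a b hab => by
        have h := Subtype.ext_iff.1 hab
        exact Subtype.ext (Subtype.ext h)
  refine isArtinian_of_surjective_of_map_ker_le f
    ((coboundaries K L n).mkQ.submoduleMap (cocyclesVanishingAbove K L n p))
    (LinearMap.submoduleMap_surjective _ _) (P.comap Q.subtype) ?_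
  rintro _ ⟨z, hz, rfl⟩
  obtain ⟨w, hw⟩ := exists_sub_δ_mem hP z.2 (p + n - 1) (p + n) rfl (by lia) fun x =>
    (hπ0 _).1 (LinearMap.congr_fun (LinearMap.mem_ker.1 hz) x)
  refine ⟨_, hw, ?_⟩
  change (coboundaries K L n).mkQ (z.1 - δ (n - 1) n w) = (coboundaries K L n).mkQ z.1
  rw [map_sub, sub_eq_self]
  exact (Submodule.Quotient.mk_eq_zero _).2 ⟨w, rfl⟩

end Filtration

/-! ### Artinian cohomology of Hom complexes, and null-homotopic multiplications. -/

section HomologyOfHom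

variable {S : Type u} [CommRing S] {K L : CochainComplex (ModuleCat.{u} S) ℤ}

theorem isArtinian_map_cocyclesVanishingAbove (n a : ℤ) [K.IsStrictlyGE a]
    (hK : IsTermwiseFGProjective K) (hL : ∀ i, IsArtinian S (L.homology i)) (k : ℕ) :
    IsArtinian S ((cocyclesVanishingAbove K L n (a - 1 + k)).map (coboundaries K L n).mkQ) := by
  induction k with
  | zero =>
    have : K.IsStrictlyGE (a - 1 + (0 : ℕ) + 1) := by simpa
    rw [cocyclesVanishingAbove_eq_bot, Submodule.map_bot]
    infer_instance
  | succ k ih =>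
    refine isArtinian_map_cocyclesVanishingAbove_succ n _ (hK _).1 (hK _).2 (hL _) ?_
    rwa [show a - 1 + ((k + 1 : ℕ) : ℤ) - 1 = a - 1 + k by push_cast; ring]

theorem isArtinian_homology_homComplex (hKf : IsFiniteComplex K) (hK : IsTermwiseFGProjective K)
    (hL : ∀ i, IsArtinian S (L.homology i)) (n : ℤ) :
    IsArtinian S ((homComplex K L).homology n) := by
  obtain ⟨a, b, _, _⟩ := hKf
  -- This many steps lead from `a - 1`, where the filtration is zero, up to at least `b`, where it
  -- is everything; `toNat` also covers `b < a`.
  have := isArtinian_map_cocyclesVanishingAbove n a hK hL (b - a + 1).toNat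
  have hb : K.IsStrictlyLE (a - 1 + (b - a + 1).toNat) := K.isStrictlyLE_of_le b _ (by lia)
  obtain ⟨π, hπ, hπ0⟩ := exists_cycles_to_homology (homComplex K L) (n - 1) n (n + 1)
    (by simp) (by simp)
  let F := cocyclesVanishingAbove K L n (a - 1 + (b - a + 1).toNat)
  let f : LinearMap.ker ((homComplex K L).d n (n + 1)).hom →ₗ[S] F.map (coboundaries K L n).mkQ :=
    LinearMap.codRestrict _ ((coboundaries K L n).mkQ.comp (Submodule.subtype _)) fun z =>
      ⟨z.1, mem_cocyclesVanishingAbove_of_isStrictlyLE z.2, rfl⟩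
  refine isArtinian_of_surjective_of_map_ker_le f π hπ ⊥ ?_
  rintro _ ⟨z, hz, rfl⟩
  refine (Submodule.mem_bot S).2 ((hπ0 z).2 ?_)
  obtain ⟨w, hw⟩ := (Submodule.Quotient.mk_eq_zero (coboundaries K L n)).1 (Subtype.ext_iff.1 hz)
  exact ⟨w, hw⟩

/-- The elements `s` such that `s • 𝟙 K` agrees, up to homotopy, with a cocycle
vanishing above `p`. -/
def nullIdealAbove (K : CochainComplex (ModuleCat.{u} S) ℤ) (p : ℤ) : Ideal S :=
  (cocyclesVanishingAbove K K 0 p ⊔ coboundaries K K 0).comap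
    (LinearMap.toSpanSingleton S (Cochain K K 0) (Cochain.ofHom (𝟙 K)))

/-- The elements `s` such that `s • 𝟙 K` is null-homotopic. -/
def nullIdeal (K : CochainComplex (ModuleCat.{u} S) ℤ) : Ideal S :=
  (coboundaries K K 0).comap
    (LinearMap.toSpanSingleton S (Cochain K K 0) (Cochain.ofHom (𝟙 K)))

theorem mem_nullIdeal_iff {s : S} :
    s ∈ nullIdeal K ↔ ∃ w : Cochain K K (-1), δ (-1) 0 w = s • Cochain.ofHom (𝟙 K) :=
  Iff.rfl

/-- Multiplying by `r ∈ I` turns the degree `p` component from cycles into boundaries, so it can be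
removed by a homotopy. -/
theorem mul_nullIdealAbove_le (I : Ideal S) (hK : IsTermwiseFGProjective K)
    (hI : ∀ s ∈ I, ∀ i, ∀ x : K.homology i, s • x = 0) (p : ℤ) :
    I * nullIdealAbove K p ≤ nullIdealAbove K (p - 1) := by
  rw [Ideal.mul_le]
  intro r hr s hs
  obtain ⟨z, hz, w, hw, hzw⟩ := Submodule.mem_sup.1 hs
  obtain ⟨π, hπ, hπ0⟩ := exists_cycles_to_homology K (p - 1) p (p + 1) (by simp) (by simp)
  obtain ⟨w', hw'⟩ := exists_sub_δ_mem (hK p).2 (Submodule.smul_mem _ r hz) (p - 1) p (add_zero p)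
    (by lia) fun x => by
      have h := d_v_eq_zero hz p (p + 1) (add_zero p) rfl
      have hx : (K.d p (p + 1)).hom ((z.v p p (add_zero p)).hom x) = 0 :=
        LinearMap.congr_fun (congrArg ModuleCat.Hom.hom h) x
      have h2 : π (r • ⟨(z.v p p (add_zero p)).hom x, hx⟩) = 0 := by
        rw [map_smul, hI r hr]
      exact (hπ0 _).1 h2
  refine Submodule.mem_sup.2 ⟨_, hw', _, Submodule.add_mem _ ⟨w', rfl⟩ (Submodule.smul_mem _ r hw), ?_⟩
  rw [LinearMap.toSpanSingleton_apply] at hzw ⊢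
  rw [mul_smul, ← hzw, smul_add, δ_hom_apply]
  abel

theorem pow_le_nullIdealAbove (I : Ideal S) (hK : IsTermwiseFGProjective K)
    (hI : ∀ s ∈ I, ∀ i, ∀ x : K.homology i, s • x = 0) (b : ℤ) [K.IsStrictlyLE b] (k : ℕ) :
    I ^ k ≤ nullIdealAbove K (b - k) := by
  induction k with
  | zero =>
    intro s _
    refine Submodule.mem_sup_left (Submodule.smul_mem _ s ?_)
    have : K.IsStrictlyLE (b - (0 : ℕ)) := by simpa
    exact mem_cocyclesVanishingAbove_of_isStrictlyLE (δ_ofHom _)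
  | succ k ih =>
    rw [pow_succ', show b - ((k + 1 : ℕ) : ℤ) = b - k - 1 by push_cast; ring]
    exact (Ideal.mul_mono_right ih).trans (mul_nullIdealAbove_le I hK hI _)

theorem exists_pow_le_nullIdeal (I : Ideal S) (hKf : IsFiniteComplex K)
    (hK : IsTermwiseFGProjective K) (hI : ∀ s ∈ I, ∀ i, ∀ x : K.homology i, s • x = 0) :
    ∃ k : ℕ, I ^ k ≤ nullIdeal K := by
  obtain ⟨a, b, _, _⟩ := hKf
  refine ⟨(b - a + 1).toNat, fun s hs => ?_⟩
  have h := pow_le_nullIdealAbove I hK hI b _ hs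
  have : K.IsStrictlyGE (b - (b - a + 1).toNat + 1) := K.isStrictlyGE_of_ge _ a (by lia)
  rwa [nullIdealAbove, cocyclesVanishingAbove_eq_bot, bot_sup_eq] at h

theorem smul_eq_zero_of_mem_nullIdeal {s : S} (hs : s ∈ nullIdeal K) (n : ℤ)
    (x : (homComplex K L).homology n) : s • x = 0 := by
  obtain ⟨π, hπ, hπ0⟩ := exists_cycles_to_homology (homComplex K L) (n - 1) n (n + 1)
    (by simp) (by simp)
  obtain ⟨z, rfl⟩ := hπ x
  obtain ⟨w, hw⟩ := mem_nullIdeal_iff.1 hs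
  rw [← map_smul, hπ0]
  let z' : Cochain K L n := z.1
  have hz : δ n (n + 1) z' = 0 := z.2
  -- The sign cancels the one in the Leibniz rule for `δ (w.comp z')`, where `δ z' = 0`.
  refine ⟨n.negOnePow • w.comp z' (by lia : -1 + n = n - 1), ?_⟩
  change δ (n - 1) n (n.negOnePow • w.comp z' (by lia : -1 + n = n - 1)) = s • z'
  rw [δ_units_smul, δ_comp w z' _ 0 (n + 1) n (by lia) (by lia) (by lia), hz, hw]
  simp [smul_smul]

end HomologyOfHom

open CochainComplex

/-! ### Cones of multiplication maps and Koszul complexes. -/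

section Cone

variable {S : Type u} [CommRing S] {K L : CochainComplex (ModuleCat.{u} S) ℤ}

theorem ofHom_smul (s : S) (f : K ⟶ L) : Cochain.ofHom (s • f) = s • Cochain.ofHom f := by
  ext p
  simp

/-- The null-homotopy sends the summand `K` identically onto the shifted summand. -/
theorem mem_nullIdeal_mappingCone_self (s : S) :
    s ∈ nullIdeal (mappingCone (s • 𝟙 K)) := by
  rw [mem_nullIdeal_iff]
  refine ⟨mappingCone.descCochain (s • 𝟙 K) (0 : Cochain K _ (-2))
    (mappingCone.inl (s • 𝟙 K)) (by lia), ?_⟩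
  rw [mappingCone.δ_descCochain _ _ _ _ 0 (by lia), mappingCone.δ_inl, ← mappingCone.id]
  simp [ofHom_smul]

/-- A null-homotopy on `K` acts on both summands of the cone, with a sign on the shifted one. Thus
elements made null by one cone stay null under later cones. -/
theorem nullIdeal_le_nullIdeal_mappingCone (s : S) :
    nullIdeal K ≤ nullIdeal (mappingCone (s • 𝟙 K)) := by
  intro t ht
  obtain ⟨w, hw⟩ := mem_nullIdeal_iff.1 ht
  rw [mem_nullIdeal_iff]
  refine ⟨mappingCone.descCochain (s • 𝟙 K)
    (-w.comp (mappingCone.inl (s • 𝟙 K)) (by lia : (-1 : ℤ) + (-1) = -2))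
    (w.comp (Cochain.ofHom (mappingCone.inr (s • 𝟙 K))) (add_zero _)) (by lia), ?_⟩
  rw [mappingCone.δ_descCochain _ _ _ _ 0 (by lia), ← mappingCone.id, δ_neg,
    δ_comp w (mappingCone.inl (s • 𝟙 K)) (by lia : (-1 : ℤ) + (-1) = -2) 0 0 (-1)
      (by lia) (by lia) (by lia), δ_comp_ofHom, mappingCone.δ_inl, hw]
  simp [ofHom_smul]

theorem isFiniteComplex_mappingCone (hK : IsFiniteComplex K) (φ : K ⟶ K) :
    IsFiniteComplex (mappingCone φ) := by
  obtain ⟨a, b, _, _⟩ := hK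
  refine ⟨a - 1, b, ?_, ?_⟩
  · rw [isStrictlyGE_iff]
    intro i hi
    rw [mappingCone.isZero_X_iff]
    exact ⟨K.isZero_of_isStrictlyGE a _ (by lia), K.isZero_of_isStrictlyGE a _ (by lia)⟩
  · rw [isStrictlyLE_iff]
    intro i hi
    rw [mappingCone.isZero_X_iff]
    exact ⟨K.isZero_of_isStrictlyLE b _ (by lia), K.isZero_of_isStrictlyLE b _ (by lia)⟩

theorem isTermwiseFGProjective_mappingCone (hK : IsTermwiseFGProjective K) (φ : K ⟶ K) :
    IsTermwiseFGProjective (mappingCone φ) := by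
  intro i
  have := (hK i).1
  have := (hK i).2
  have := (hK (i + 1)).1
  have := (hK (i + 1)).2
  let f : (mappingCone φ).X i →ₗ[S] K.X (i + 1) × K.X i :=
    ((mappingCone.fst φ).1.v i (i + 1) rfl).hom.prod
      ((mappingCone.snd φ).v i i (add_zero i)).hom
  let g : K.X (i + 1) × K.X i →ₗ[S] (mappingCone φ).X i :=
    ((mappingCone.inl φ).v (i + 1) i (by lia)).hom.coprod ((mappingCone.inr φ).f i).hom
  have hgf : g.comp f = LinearMap.id := by
    have h := mappingCone.id_X φ i (i + 1) rfl
    ext x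
    exact LinearMap.congr_fun (congrArg ModuleCat.Hom.hom h) x
  exact ⟨Module.Finite.of_surjective g fun x => ⟨f x, LinearMap.congr_fun hgf x⟩,
    Module.Projective.of_split f g hgf⟩

/-- Precomposition with a morphism of complexes, on cochains. -/
def precompCochain {K' : CochainComplex (ModuleCat.{u} S) ℤ} (f : K ⟶ K')
    (L : CochainComplex (ModuleCat.{u} S) ℤ) (n : ℤ) : Cochain K' L n →ₗ[S] Cochain K L n where
  toFun z := (Cochain.ofHom f).comp z (zero_add n)
  map_add' _ _ := Cochain.comp_add _ _ _ _
  map_smul' _ _ := Cochain.comp_smul _ _ _ _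

/-- In the long exact sequence of the cone, the kernel of `s` on the cohomology of `homComplex K L`
is the image of the cohomology for the cone, so `isArtinian_of_ker_smul` applies. -/
theorem isArtinian_homology_homComplex_of_mappingCone (s : S) (n : ℤ)
    (htors : ∀ z : Cochain K L n, ∃ k : ℕ, s ^ k • z = 0)
    (h : IsArtinian S ((homComplex (mappingCone (s • 𝟙 K)) L).homology n)) :
    IsArtinian S ((homComplex K L).homology n) := by
  obtain ⟨π, hπ, hπ0⟩ := exists_cycles_to_homology (homComplex K L) (n - 1) n (n + 1)
    (by simp) (by simp)
  obtain ⟨π', hπ', hπ0'⟩ := exists_cycles_to_homology (homComplex (mappingCone (s • 𝟙 K)) L)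
    (n - 1) n (n + 1) (by simp) (by simp)
  let ρ : LinearMap.ker ((homComplex (mappingCone (s • 𝟙 K)) L).d n (n + 1)).hom →ₗ[S]
      LinearMap.ker ((homComplex K L).d n (n + 1)).hom :=
    (precompCochain (mappingCone.inr (s • 𝟙 K)) L n).restrict fun z hz => by
      change δ n (n + 1) ((Cochain.ofHom _).comp z (zero_add n)) = 0
      rw [δ_ofHom_comp, show δ n (n + 1) z = 0 from hz, Cochain.comp_zero]
  have hρ : IsArtinian S (LinearMap.range (π.comp ρ)) := by
    refine isArtinian_of_surjective_of_map_ker_le π' (π.comp ρ).rangeRestrict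
      (LinearMap.surjective_rangeRestrict _) ⊥ ?_
    rintro _ ⟨z, hz, rfl⟩
    obtain ⟨w, hw⟩ := (hπ0' z).1 hz
    let w' : Cochain (mappingCone (s • 𝟙 K)) L (n - 1) := w
    have hw' : δ (n - 1) n w' = z.1 := hw
    refine (Submodule.mem_bot S).2 (Subtype.ext ((hπ0 (ρ z)).2
      ⟨precompCochain (mappingCone.inr (s • 𝟙 K)) L (n - 1) w', ?_⟩))
    change δ (n - 1) n ((Cochain.ofHom _).comp w' (zero_add _)) =
      (Cochain.ofHom _).comp z.1 (zero_add n)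
    rw [δ_ofHom_comp, hw']
  refine isArtinian_of_ker_smul s (fun m => ?_) (LinearMap.range (π.comp ρ)) fun m hm => ?_
  · obtain ⟨z, rfl⟩ := hπ m
    obtain ⟨k, hk⟩ := htors z.1
    exact ⟨k, by rw [← map_smul, show s ^ k • z = 0 from Subtype.ext hk, map_zero]⟩
  · obtain ⟨z, rfl⟩ := hπ m
    rw [← map_smul] at hm
    obtain ⟨y, hy⟩ := (hπ0 _).1 hm
    let z' : Cochain K L n := z.1
    let y' : Cochain K L (n - 1) := y
    have hz : δ n (n + 1) z' = 0 := z.2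
    have hy' : δ (n - 1) n y' = s • z' := hy
    -- A relation `s • z' = δ y'` is exactly what extends `z'` to a cocycle on the cone, with `y'`
    -- up to sign on the shifted summand.
    let x : Cochain (mappingCone (s • 𝟙 K)) L n := mappingCone.descCochain (s • 𝟙 K)
      (n.negOnePow • y') z' (by lia)
    refine ⟨⟨x, ?_⟩, ?_⟩
    · change δ n (n + 1) x = 0
      rw [mappingCone.δ_descCochain _ _ _ _ (n + 1) rfl, hz, δ_units_smul, hy']
      simp [ofHom_smul, Int.negOnePow_succ]
    · have hx : (Cochain.ofHom (mappingCone.inr (s • 𝟙 K))).comp x (zero_add n) = z' :=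
        mappingCone.inr_descCochain _ _ _ _
      rw [LinearMap.comp_apply]
      congr 1
      exact Subtype.ext hx

theorem exists_pow_smul_cochain_eq_zero (hKf : IsFiniteComplex K)
    (hK : ∀ i, Module.Finite S (K.X i)) (s : S) (hL : ∀ i, ∀ x : L.X i, ∃ k : ℕ, s ^ k • x = 0)
    (n : ℤ) (z : Cochain K L n) : ∃ k : ℕ, s ^ k • z = 0 := by
  obtain ⟨a, b, _, _⟩ := hKf
  have hloc : ∀ p, ∃ k : ℕ, ∀ l ≥ k, s ^ l • z.v p (p + n) rfl = 0 := by
    intro p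
    have := hK p
    obtain ⟨r, e, he⟩ := Module.Finite.exists_fin (R := S) (M := K.X p)
    choose k hk using fun i => hL _ ((z.v p (p + n) rfl).hom (e i))
    refine ⟨Finset.univ.sup k, fun l hl => ModuleCat.hom_ext (LinearMap.ext_on_range he fun i => ?_)⟩
    change s ^ l • (z.v p (p + n) rfl).hom (e i) = 0
    obtain ⟨c, rfl⟩ := Nat.exists_eq_add_of_le ((Finset.le_sup (Finset.mem_univ i)).trans hl)
    rw [pow_add, mul_comm, mul_smul, hk, smul_zero]
  choose k hk using hloc
  refine ⟨(Finset.Icc a b).sup k, Cochain.ext _ _ fun p q hpq => ?_⟩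
  subst hpq
  rw [Cochain.smul_v, Cochain.zero_v]
  by_cases hp : p ∈ Finset.Icc a b
  · exact hk p _ (Finset.le_sup hp)
  · rw [Finset.mem_Icc, not_and_or] at hp
    rcases hp with hp | hp
    · exact (K.isZero_of_isStrictlyGE a p (by lia)).eq_of_src _ _
    · exact (K.isZero_of_isStrictlyLE b p (by lia)).eq_of_src _ _

/-- Iterated mapping cones: a Koszul-type complex over `K` on the elements of a list. -/
theorem exists_koszul (l : List S) : ∀ K : CochainComplex (ModuleCat.{u} S) ℤ,
    IsFiniteComplex K → IsTermwiseFGProjective K →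
    ∃ K' : CochainComplex (ModuleCat.{u} S) ℤ, IsFiniteComplex K' ∧ IsTermwiseFGProjective K' ∧
      nullIdeal K ≤ nullIdeal K' ∧ (∀ s ∈ l, s ∈ nullIdeal K') ∧
      ∀ L : CochainComplex (ModuleCat.{u} S) ℤ,
        (∀ s ∈ l, ∀ i, ∀ x : L.X i, ∃ k : ℕ, s ^ k • x = 0) →
        (∀ n, IsArtinian S ((homComplex K' L).homology n)) →
        ∀ n, IsArtinian S ((homComplex K L).homology n) := by
  induction l with
  | nil => exact fun K hf hp => ⟨K, hf, hp, le_rfl, by simp, fun L _ h => h⟩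
  | cons s l ih =>
    intro K hf hp
    obtain ⟨K', hf', hp', hle, hl, h⟩ := ih (mappingCone (s • 𝟙 K))
      (isFiniteComplex_mappingCone hf _) (isTermwiseFGProjective_mappingCone hp _)
    refine ⟨K', hf', hp', (nullIdeal_le_nullIdeal_mappingCone s).trans hle, ?_, ?_⟩
    · intro t ht
      rcases List.mem_cons.1 ht with rfl | ht
      · exact hle (mem_nullIdeal_mappingCone_self t)
      · exact hl t ht
    · intro L hL hA n
      refine isArtinian_homology_homComplex_of_mappingCone s n
        (exists_pow_smul_cochain_eq_zero hf (fun i => (hp i).1) s (hL s List.mem_cons_self) n) ?_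
      exact h L (fun t ht => hL t (List.mem_cons_of_mem _ ht)) hA n

theorem smul_homology_eq_zero_of_mem_nullIdeal {s : S} (hs : s ∈ nullIdeal K) (n : ℤ)
    (x : K.homology n) : s • x = 0 := by
  obtain ⟨π, hπ, hπ0⟩ := exists_cycles_to_homology K (n - 1) n (n + 1) (by simp) (by simp)
  obtain ⟨z, rfl⟩ := hπ x
  obtain ⟨w, hw⟩ := mem_nullIdeal_iff.1 hs
  rw [← map_smul, hπ0]
  refine ⟨(w.v n (n - 1) (by lia)).hom z.1, ?_⟩
  have h := Cochain.congr_v hw n n (add_zero n)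
  rw [δ_v (-1) 0 (by lia) w n n (add_zero n) (n - 1) (n + 1) rfl rfl] at h
  have h2 := LinearMap.congr_fun (congrArg ModuleCat.Hom.hom h) z.1
  have h3 : (K.d n (n + 1)).hom z.1 = 0 := z.2
  simpa [h3] using h2

end Cone

/-! ### Resolutions by finitely generated projectives. -/

section Resolution

variable {S : Type u} [CommRing S]

/-- The map induced by a morphism of short complexes on kernels. -/
def kerMap {T T' : ShortComplex (ModuleCat.{u} S)} (φ : T ⟶ T') :
    LinearMap.ker T.g.hom →ₗ[S] LinearMap.ker T'.g.hom :=
  φ.τ₂.hom.restrict fun z hz => by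
    have h := LinearMap.congr_fun (congrArg ModuleCat.Hom.hom φ.comm₂₃) z
    change T'.g.hom (φ.τ₂.hom z) = φ.τ₃.hom (T.g.hom z) at h
    rw [LinearMap.mem_ker, h, LinearMap.mem_ker.1 hz, map_zero]

theorem homologyMap_kerToHomology {T T' : ShortComplex (ModuleCat.{u} S)} (φ : T ⟶ T')
    (z : LinearMap.ker T.g.hom) :
    (ShortComplex.homologyMap φ).hom (kerToHomology T z) = kerToHomology T' (kerMap φ z) := by
  let k : T.moduleCatLeftHomologyData.K ⟶ T'.moduleCatLeftHomologyData.K :=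
    ModuleCat.ofHom (kerMap φ)
  have h2 : T.moduleCatCyclesIso.inv ≫ ShortComplex.cyclesMap φ =
      k ≫ T'.moduleCatCyclesIso.inv := by
    rw [← cancel_mono T'.iCycles, Category.assoc, Category.assoc, ShortComplex.cyclesMap_i,
      ShortComplex.moduleCatCyclesIso_inv_iCycles_assoc,
      ShortComplex.moduleCatCyclesIso_inv_iCycles]
    rfl
  have h : (T.moduleCatCyclesIso.inv ≫ T.homologyπ) ≫ ShortComplex.homologyMap φ =
      k ≫ T'.moduleCatCyclesIso.inv ≫ T'.homologyπ := by
    rw [Category.assoc, ShortComplex.homologyπ_naturality, reassoc_of% h2]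
  exact LinearMap.congr_fun (congrArg ModuleCat.Hom.hom h) z

theorem shortComplex_quasiIso {T T' : ShortComplex (ModuleCat.{u} S)} (φ : T ⟶ T')
    (hinj : ∀ z, T.g.hom z = 0 → (∃ y, T'.f.hom y = φ.τ₂.hom z) → ∃ y, T.f.hom y = z)
    (hsurj : ∀ c, T'.g.hom c = 0 → ∃ z, T.g.hom z = 0 ∧ ∃ y, T'.f.hom y = c - φ.τ₂.hom z) :
    ShortComplex.QuasiIso φ := by
  rw [ShortComplex.quasiIso_iff, ConcreteCategory.isIso_iff_bijective]
  refine ⟨(injective_iff_map_eq_zero _).2 fun x hx => ?_, fun x => ?_⟩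
  · obtain ⟨z, rfl⟩ := kerToHomology_surjective T x
    have hx' := (homologyMap_kerToHomology φ z).symm.trans hx
    exact (kerToHomology_eq_zero_iff T z).2 (hinj z.1 z.2 ((kerToHomology_eq_zero_iff T' _).1 hx'))
  · obtain ⟨c, rfl⟩ := kerToHomology_surjective T' x
    obtain ⟨z, hz, hy⟩ := hsurj c.1 c.2
    refine ⟨kerToHomology T ⟨z, hz⟩, (homologyMap_kerToHomology φ _).trans ?_⟩
    rw [eq_comm, ← sub_eq_zero, ← map_sub]
    exact (kerToHomology_eq_zero_iff T' _).2 hy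

theorem exists_finite_generators (T : ShortComplex (ModuleCat.{u} S))
    [Module.Finite S T.homology] : ∃ (l : ℕ) (g : (Fin l → S) →ₗ[S] LinearMap.ker T.g.hom),
      ∀ c, T.g.hom c = 0 → ∃ v y, T.f.hom y = c - g v := by
  obtain ⟨l, p, hp⟩ := Module.Finite.exists_fin' S T.homology
  obtain ⟨g, hg⟩ := Module.projective_lifting_property (kerToHomology T) p
    (kerToHomology_surjective T)
  refine ⟨l, g, fun c hc => ?_⟩
  obtain ⟨v, hv⟩ := hp (kerToHomology T ⟨c, hc⟩)
  refine ⟨v, (kerToHomology_eq_zero_iff T (⟨c, hc⟩ - g v)).1 ?_⟩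
  rw [map_sub, ← hv, ← hg, LinearMap.comp_apply, sub_self]

/-- One term of a resolution: a finitely generated projective module over `M`, together with the
submodule of its cycles. -/
structure ResolutionStage (S : Type u) [CommRing S] (M : ModuleCat.{u} S) where
  /-- The term. -/
  P : ModuleCat.{u} S
  finite : Module.Finite S P
  projective : Module.Projective S P
  /-- The cycles. -/
  Z : Submodule S P
  /-- The comparison map. -/
  f : P →ₗ[S] M

/-- The new term is a sum of two free modules. One covers `W`, the cycles that become boundaries in
the target, and yields injectivity on homology one degree below; `W` is finitely generated as `S` is
Noetherian. The other has zero differential and hits generators of the homology, which yields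
surjectivity. -/
theorem exists_next_stage [IsNoetherianRing S] (T : ShortComplex (ModuleCat.{u} S))
    [Module.Finite S T.homology] (s : ResolutionStage S T.X₃) :
    ∃ (s' : ResolutionStage S T.X₂) (d : s'.P →ₗ[S] s.P), s'.Z = LinearMap.ker d ∧
      LinearMap.range d = s.Z ⊓ (LinearMap.range T.g.hom).comap s.f ∧
      T.g.hom.comp s'.f = s.f.comp d ∧
      ∀ c, T.g.hom c = 0 → ∃ z ∈ s'.Z, ∃ y, T.f.hom y = c - s'.f z := by
  have := s.finite
  let W := s.Z ⊓ (LinearMap.range T.g.hom).comap s.f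
  obtain ⟨m, p, hp⟩ := Module.Finite.exists_fin' S W
  obtain ⟨l, g, hg⟩ := exists_finite_generators T
  obtain ⟨v, hv⟩ := Module.projective_lifting_property T.g.hom.rangeRestrict
    ((s.f.comp (W.subtype.comp p)).codRestrict (LinearMap.range T.g.hom) fun x => (p x).2.2)
    (LinearMap.surjective_rangeRestrict _)
  have hv' : ∀ x, T.g.hom (v x) = s.f (p x) := fun x =>
    congrArg Subtype.val (LinearMap.congr_fun hv x)
  let d : ((Fin m → S) × (Fin l → S)) →ₗ[S] s.P :=
    (W.subtype.comp p).comp (LinearMap.fst S (Fin m → S) (Fin l → S))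
  refine ⟨⟨ModuleCat.of S ((Fin m → S) × (Fin l → S)), ?_, ?_, LinearMap.ker d,
    v.coprod ((LinearMap.ker T.g.hom).subtype.comp g)⟩, d, rfl, ?_, ?_, fun c hc => ?_⟩
  · exact inferInstanceAs (Module.Finite S ((Fin m → S) × (Fin l → S)))
  · exact inferInstanceAs (Module.Projective S ((Fin m → S) × (Fin l → S)))
  · ext w
    constructor
    · rintro ⟨x, rfl⟩
      exact (p x.1).2
    · intro hw
      obtain ⟨x, hx⟩ := hp ⟨w, hw⟩
      exact ⟨(x, 0), congrArg Subtype.val hx⟩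
  · refine LinearMap.ext fun x => ?_
    change T.g.hom (v x.1 + (g x.2).1) = s.f (p x.1)
    rw [map_add, hv', LinearMap.mem_ker.1 (g x.2).2, add_zero]
  · obtain ⟨x, y, hy⟩ := hg c hc
    refine ⟨((0 : Fin m → S), x), ?_, y, ?_⟩
    · change ((p 0 : W) : s.P) = 0
      rw [map_zero]
      rfl
    · change _ = c - (v 0 + (g x).1)
      rw [hy, map_zero, zero_add]

/-- A complex in nonpositive degrees with finitely generated homology over a Noetherian ring is
resolved by finitely generated projective modules. -/
theorem exists_quasiIso_chainComplex [IsNoetherianRing S]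
    (A : ChainComplex (ModuleCat.{u} S) ℕ) (hA : ∀ n, Module.Finite S (A.homology n)) :
    ∃ (P : ChainComplex (ModuleCat.{u} S) ℕ) (f : P ⟶ A), QuasiIso f ∧
      ∀ n, Module.Finite S (P.X n) ∧ Module.Projective S (P.X n) := by
  have hfin : ∀ i j k, (ComplexShape.down ℕ).prev j = i → (ComplexShape.down ℕ).next j = k →
      Module.Finite S (A.sc' i j k).homology := by
    rintro i j k rfl rfl
    exact hA j
  have hfin0 : Module.Finite S (A.sc' 1 0 0).homology := hfin 1 0 0 (by simp) (by simp)
  have hfinS : ∀ k, Module.Finite S (A.sc' (k + 2) (k + 1) k).homology := fun k =>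
    hfin _ _ _ (by simp) (by simp)
  -- A zero term below degree 0 starts the recursion; since `d₀` lands in it, every element of
  -- degree 0 is a cycle.
  let s₀ : ResolutionStage S (A.sc' 1 0 0).X₃ :=
    ⟨ModuleCat.of S PUnit.{u + 1}, inferInstanceAs (Module.Finite S PUnit.{u + 1}),
      inferInstanceAs (Module.Projective S PUnit.{u + 1}), ⊥, 0⟩
  obtain ⟨t₀, d₀, hZ₀, -, -, hs₀⟩ := exists_next_stage (A.sc' 1 0 0) s₀
  choose nxt δ hZ hr hc hs using fun k => exists_next_stage (A.sc' (k + 2) (k + 1) k)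
  let t : ∀ k, ResolutionStage S (A.X k) := fun k => Nat.rec t₀ (fun k s => nxt k s) k
  let D : ∀ k, (t (k + 1)).P →ₗ[S] (t k).P := fun k => δ k (t k)
  have hZ' : ∀ k, (t (k + 1)).Z = LinearMap.ker (D k) := fun k => hZ k (t k)
  have hr' : ∀ k, LinearMap.range (D k) = (t k).Z ⊓ (LinearMap.range (A.d (k + 1) k).hom).comap (t k).f :=
    fun k => hr k (t k)
  have hc' : ∀ k, (A.d (k + 1) k).hom.comp (t (k + 1)).f = (t k).f.comp (D k) :=
    fun k => hc k (t k)
  have hs' : ∀ k c, (A.d (k + 1) k).hom c = 0 → ∃ z ∈ (t (k + 1)).Z,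
      ∃ y, (A.d (k + 2) (k + 1)).hom y = c - (t (k + 1)).f z := fun k => hs k (t k)
  have hZtop : (t 0).Z = ⊤ := by
    change t₀.Z = ⊤
    rw [hZ₀, eq_top_iff]
    intro x _
    exact Subsingleton.elim (α := PUnit.{u + 1}) _ _
  have hDD : ∀ k, ModuleCat.ofHom (D (k + 1)) ≫ ModuleCat.ofHom (D k) = 0 := by
    intro k
    ext x
    have h : D (k + 1) x ∈ LinearMap.range (D (k + 1)) := ⟨x, rfl⟩
    rw [hr', hZ'] at h
    exact h.1
  let P : ChainComplex (ModuleCat.{u} S) ℕ :=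
    ChainComplex.of (fun k => (t k).P) (fun k => ModuleCat.ofHom (D k)) hDD
  have hPd : ∀ k, P.d (k + 1) k = ModuleCat.ofHom (D k) := fun k =>
    ChainComplex.of_d (fun k => (t k).P) (fun k => ModuleCat.ofHom (D k)) k
  let f : P ⟶ A :=
    { f := fun k => ModuleCat.ofHom (t k).f
      comm' := by
        rintro _ k rfl
        rw [hPd]
        ext x
        exact LinearMap.congr_fun (hc' k) x }
  refine ⟨P, f, (quasiIso_iff f).2 fun k => ?_, fun n => ⟨(t n).finite, (t n).projective⟩⟩
  rcases k with _ | k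
  · rw [quasiIsoAt_iff' f 1 0 0 (by simp) (by simp)]
    refine shortComplex_quasiIso _ ?_ ?_
    · rintro z _ ⟨y, hy⟩
      have hz : z ∈ LinearMap.range (D 0) := by
        rw [hr', hZtop]
        exact ⟨trivial, y, hy⟩
      change ∃ y, (P.d 1 0).hom y = z
      rwa [hPd]
    · intro c hc
      obtain ⟨z, _, hy⟩ := hs₀ c hc
      refine ⟨z, ?_, hy⟩
      change (P.d 0 0).hom z = 0
      rw [P.shape 0 0 (by simp)]
      rfl
  · rw [quasiIsoAt_iff' f (k + 2) (k + 1) k (by simp) (by simp)]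
    refine shortComplex_quasiIso _ ?_ ?_
    · rintro z hz ⟨y, hy⟩
      change (P.d (k + 1) k).hom z = 0 at hz
      rw [hPd] at hz
      have hz : z ∈ LinearMap.range (D (k + 1)) := by
        rw [hr', hZ']
        exact ⟨hz, y, hy⟩
      change ∃ y, (P.d (k + 1 + 1) (k + 1)).hom y = z
      rwa [hPd]
    · intro c hc
      obtain ⟨z, hz, hy⟩ := hs' k c hc
      rw [hZ'] at hz
      refine ⟨z, ?_, hy⟩
      change (P.d (k + 1) k).hom z = 0
      rwa [hPd]

end Resolution

/-! ### Resolving the Hom complex, the unit complex, and powers of `J`. -/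

section Main

variable {S : Type u} [CommRing S]

theorem isStrictlyLE_homComplex {K L : CochainComplex (ModuleCat.{u} S) ℤ} (a b : ℤ)
    [K.IsStrictlyGE a] [L.IsStrictlyLE b] : (homComplex K L).IsStrictlyLE (b - a) := by
  rw [isStrictlyLE_iff]
  intro n hn
  have : Subsingleton ((homComplex K L).X n) := by
    refine ⟨fun (z z' : Cochain K L n) => Cochain.ext _ _ fun p q hpq => ?_⟩
    by_cases hp : p < a
    · exact (K.isZero_of_isStrictlyGE a p hp).eq_of_src _ _
    · exact (L.isZero_of_isStrictlyLE b q (by lia)).eq_of_tgt _ _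
  exact ModuleCat.isZero_of_subsingleton _

theorem exists_fgProjective_resolution [IsNoetherianRing S]
    (C : CochainComplex (ModuleCat.{u} S) ℤ) (hC : IsBoundedAbove C)
    (hfg : ∀ n, Module.Finite S (C.homology n)) :
    ∃ P : CochainComplex (ModuleCat.{u} S) ℤ,
      IsBoundedAbove P ∧ IsTermwiseFGProjective P ∧ IsQuasiIsomorphic C P := by
  obtain ⟨b, _⟩ := hC
  let e := ComplexShape.embeddingUpIntLE b
  -- As `C` vanishes above `b`, truncation loses nothing, and `C` becomes a chain complex indexed by
  -- `ℕ`.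
  let ι : (C.truncLE' e).extend e ⟶ C := (C.truncLEIso e).inv ≫ C.ιTruncLE b
  have hι : IsIso ι := inferInstance
  obtain ⟨P, f, hf, hP⟩ := exists_quasiIso_chainComplex (C.truncLE' e) fun n => by
    let i : C.homology (e.f n) ≅ (C.truncLE' e).homology n :=
      (asIso (HomologicalComplex.homologyMap ι (e.f n))).symm ≪≫
        (C.truncLE' e).extendHomologyIso e rfl
    have := hfg (e.f n)
    exact Module.Finite.equiv i.toLinearEquiv
  refine ⟨P.extend e, ⟨b, inferInstance⟩, fun n => ?_, ?_⟩
  · by_cases hn : ∃ i, e.f i = n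
    · obtain ⟨i, hi⟩ := hn
      let j := (P.extendXIso e hi).symm.toLinearEquiv
      have := (hP i).1
      have := (hP i).2
      exact ⟨Module.Finite.equiv j, Module.Projective.of_equiv j⟩
    · push Not at hn
      have := ModuleCat.subsingleton_of_isZero (P.isZero_extend_X e n hn)
      exact ⟨inferInstance, inferInstance⟩
  · have hq : QuasiIso (HomologicalComplex.extendMap f e) :=
      (HomologicalComplex.quasiIso_extendMap_iff f e).2 hf
    exact Relation.EqvGen.symm _ _ (Relation.EqvGen.rel _ _
      ⟨HomologicalComplex.extendMap f e ≫ ι, inferInstance⟩)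

theorem IsQuasiIsomorphic.homology_iso {K L : CochainComplex (ModuleCat.{u} S) ℤ}
    (h : IsQuasiIsomorphic K L) (n : ℤ) : Nonempty (K.homology n ≅ L.homology n) := by
  induction h with
  | rel A B h =>
    obtain ⟨f, hf⟩ := h
    exact ⟨asIso (HomologicalComplex.homologyMap f n)⟩
  | refl A => exact ⟨Iso.refl _⟩
  | symm A B _ ih => exact ⟨ih.some.symm⟩
  | trans A B C _ _ ih ih' => exact ⟨ih.some ≪≫ ih'.some⟩

theorem isNoetherian_homology [IsNoetherianRing S] {P : CochainComplex (ModuleCat.{u} S) ℤ}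
    (n : ℤ) (hP : Module.Finite S (P.X n)) : IsNoetherian S (P.homology n) := by
  obtain ⟨π, hπ, -⟩ := exists_cycles_to_homology P (n - 1) n (n + 1) (by simp) (by simp)
  exact isNoetherian_of_surjective π (LinearMap.range_eq_top.2 hπ)

/-- The complex with the free module of rank one in degree `0`. -/
noncomputable abbrev unitComplex (S : Type u) [CommRing S] : CochainComplex (ModuleCat.{u} S) ℤ :=
  (singleFunctor (ModuleCat.{u} S) 0).obj (ModuleCat.of S S)

theorem isTermwiseFGProjective_unitComplex : IsTermwiseFGProjective (unitComplex S) := by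
  intro i
  by_cases hi : i = 0
  · subst hi
    let j : S ≃ₗ[S] (unitComplex S).X 0 :=
      (HomologicalComplex.singleObjXSelf (.up ℤ) 0 (ModuleCat.of S S)).symm.toLinearEquiv
    exact ⟨Module.Finite.equiv j, Module.Projective.of_equiv j⟩
  · have := ModuleCat.subsingleton_of_isZero
      (HomologicalComplex.isZero_single_obj_X (.up ℤ) 0 (ModuleCat.of S S) i hi)
    exact ⟨@Module.Finite.of_finite _ _ _ _ _ (@Finite.of_subsingleton _ this),
      @Module.Projective.of_free _ _ _ _ _ (@Module.Free.of_subsingleton _ _ _ _ _ this)⟩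

/-- Evaluation at `1 : S` commutes with differentials and is onto on cycles, so it exhibits the
homology of `L` as a quotient. -/
theorem isArtinian_homology_of_homComplex_unitComplex
    (L : CochainComplex (ModuleCat.{u} S) ℤ) (n : ℤ)
    (h : IsArtinian S ((homComplex (unitComplex S) L).homology n)) :
    IsArtinian S (L.homology n) := by
  obtain ⟨π, hπ, hπ0⟩ := exists_cycles_to_homology (homComplex (unitComplex S) L) (n - 1) n (n + 1)
    (by simp) (by simp)
  obtain ⟨π', hπ', hπ0'⟩ := exists_cycles_to_homology L (n - 1) n (n + 1) (by simp) (by simp)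
  let i := (HomologicalComplex.singleObjXSelf (.up ℤ) 0 (ModuleCat.of S S))
  let o : (unitComplex S).X 0 := i.inv.hom (1 : S)
  have hio : i.hom.hom o = (1 : S) :=
    LinearMap.congr_fun (congrArg ModuleCat.Hom.hom i.inv_hom_id) (1 : S)
  let ev (m : ℤ) : Cochain (unitComplex S) L m →ₗ[S] L.X m :=
    { toFun := fun z => (z.v 0 m (zero_add m)).hom o
      map_add' := fun _ _ => rfl
      map_smul' := fun _ _ => rfl }
  have hev : ∀ m m' (z : Cochain (unitComplex S) L m), m + 1 = m' →
      (L.d m m').hom (ev m z) = ev m' (δ m m' z) := by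
    intro m m' z hm
    obtain ⟨f, rfl⟩ := Cochain.fromSingleMk_surjective z m (zero_add m)
    change _ = ((δ m m' (Cochain.fromSingleMk f (zero_add m))).v 0 m' (zero_add m')).hom o
    rw [Cochain.δ_fromSingleMk f (zero_add m) m' m' (zero_add m'), Cochain.fromSingleMk_v]
    change (L.d m m').hom (((Cochain.fromSingleMk f (zero_add m)).v 0 m (zero_add m)).hom o) = _
    rw [Cochain.fromSingleMk_v]
    rfl
  let ρ : LinearMap.ker ((homComplex (unitComplex S) L).d n (n + 1)).hom →ₗ[S]
      LinearMap.ker (L.d n (n + 1)).hom :=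
    (ev n).restrict fun z hz => by
      rw [LinearMap.mem_ker, hev n (n + 1) z rfl, show δ n (n + 1) z = 0 from hz, map_zero]
  refine isArtinian_of_surjective_of_map_ker_le π (π'.comp ρ) ?_ ⊥ ?_
  · intro x
    obtain ⟨c, rfl⟩ := hπ' x
    let f : ModuleCat.of S S ⟶ L.X n := ModuleCat.ofHom (LinearMap.toSpanSingleton S (L.X n) c.1)
    refine ⟨⟨Cochain.fromSingleMk f (zero_add n), ?_⟩, ?_⟩
    · change δ n (n + 1) (Cochain.fromSingleMk f (zero_add n)) = 0
      have hf : f ≫ L.d n (n + 1) = 0 := by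
        ext
        change (L.d n (n + 1)).hom ((1 : S) • c.1) = 0
        rw [one_smul]
        exact c.2
      rw [Cochain.δ_fromSingleMk f (zero_add n) (n + 1) (n + 1) (zero_add _), hf,
        Cochain.fromSingleMk_zero]
    · rw [LinearMap.comp_apply]
      congr 1
      refine Subtype.ext ?_
      change ((Cochain.fromSingleMk f (zero_add n)).v 0 n (zero_add n)).hom o = c.1
      rw [Cochain.fromSingleMk_v]
      change (i.hom.hom o : S) • c.1 = c.1
      rw [hio, one_smul]
  · rintro _ ⟨z, hz, rfl⟩
    obtain ⟨w, hw⟩ := (hπ0 z).1 hz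
    refine (Submodule.mem_bot S).2 ((hπ0' (ρ z)).2 ⟨ev (n - 1) w, ?_⟩)
    rw [hev (n - 1) n w (by lia)]
    exact congrArg (ev n) hw

/-- A finitely generated ideal whose elements act locally nilpotently on a finite module has a
power annihilating it. -/
theorem exists_pow_smul_eq_zero {M : Type u} [AddCommGroup M] [Module S M] [Module.Finite S M]
    {J : Ideal S} (hJ : J.FG) (h : IsIdealTorsion J M) : ∃ k : ℕ, ∀ s ∈ J ^ k, ∀ m : M, s • m = 0 := by
  have hle : J ≤ (Module.annihilator S M).radical := by
    intro s hs
    obtain ⟨r, e, he⟩ := Module.Finite.exists_fin (R := S) (M := M)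
    choose k _ hk using fun i => h s hs (e i)
    refine ⟨Finset.univ.sup k, Module.mem_annihilator.2 fun m => ?_⟩
    have : LinearMap.lsmul S M (s ^ Finset.univ.sup k) = 0 := by
      refine LinearMap.ext_on_range he fun i => ?_
      obtain ⟨c, hc⟩ := Nat.exists_eq_add_of_le (Finset.le_sup (f := k) (Finset.mem_univ i))
      rw [hc, LinearMap.lsmul_apply, pow_add, mul_comm, mul_smul, hk, smul_zero]
      rfl
    exact LinearMap.congr_fun this m
  obtain ⟨k, hk⟩ := Ideal.exists_pow_le_of_le_radical_of_fg hle hJ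
  exact ⟨k, fun s hs m => Module.mem_annihilator.1 (hk hs) m⟩

/-- Each homology module is finitely generated, hence killed by a power of `J`; only finitely many
degrees matter, so one power kills all of them and `exists_pow_le_nullIdeal` applies. -/
theorem exists_pow_le_nullIdeal_of_isIdealTorsion [IsNoetherianRing S] (J : Ideal S)
    {K : CochainComplex (ModuleCat.{u} S) ℤ} (hKf : IsFiniteComplex K)
    (hK : IsTermwiseFGProjective K) (hKJ : ∀ i, IsIdealTorsion J (K.homology i)) :
    ∃ k : ℕ, J ^ k ≤ nullIdeal K := by
  have hloc : ∀ i, ∃ k : ℕ, ∀ s ∈ J ^ k, ∀ m : K.homology i, s • m = 0 := fun i => by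
    have := isNoetherian_homology i (hK i).1
    exact exists_pow_smul_eq_zero (IsNoetherian.noetherian J) (hKJ i)
  choose k hk using hloc
  obtain ⟨a, b, ha, hb⟩ := hKf
  obtain ⟨m, hm⟩ := exists_pow_le_nullIdeal (J ^ (Finset.Icc a b).sup k) ⟨a, b, ha, hb⟩ hK
    fun s hs i x => by
      by_cases hi : i ∈ Finset.Icc a b
      · exact hk i s (Ideal.pow_le_pow_right (Finset.le_sup hi) hs) x
      · have h0 : Limits.IsZero (K.X i) := by
          rw [Finset.mem_Icc, not_and_or] at hi
          rcases hi with hi | hi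
          · exact K.isZero_of_isStrictlyGE a i (by lia)
          · exact K.isZero_of_isStrictlyLE b i (by lia)
        obtain ⟨π, hπ, -⟩ := exists_cycles_to_homology K (i - 1) i (i + 1) (by simp) (by simp)
        obtain ⟨z, rfl⟩ := hπ x
        have := ModuleCat.subsingleton_of_isZero h0
        rw [Subsingleton.elim z 0, map_zero, smul_zero]
  exact ⟨_, by rwa [← pow_mul] at hm⟩

end Main
end TorsionComplex

open TorsionComplex

theorem mainTheorem6 {S : Type u} [CommRing S] [IsNoetherianRing S] (J : Ideal S)
    (hJ : IsArtinianRing (S ⧸ J)) (N : CochainComplex (ModuleCat.{u} S) ℤ)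
    (hN : TorsionComplex.IsFiniteComplex N)
    (hNtors : ∀ i : ℤ, TorsionComplex.IsIdealTorsion J (N.X i)) :
    (∀ i : ℤ, IsArtinian S (N.homology i)) ↔
      ∀ K : CochainComplex (ModuleCat.{u} S) ℤ,
        TorsionComplex.IsFiniteComplex K →
        TorsionComplex.IsTermwiseFGProjective K →
        (∀ i : ℤ, TorsionComplex.IsIdealTorsion J (K.homology i)) →
        ∃ P : CochainComplex (ModuleCat.{u} S) ℤ,
          TorsionComplex.IsBoundedAbove P ∧
          TorsionComplex.IsTermwiseFGProjective P ∧
          TorsionComplex.IsQuasiIsomorphic (TorsionComplex.homComplex K N) P := by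
  constructor
  · intro hA K hKf hK hKJ
    obtain ⟨k, hk⟩ := exists_pow_le_nullIdeal_of_isIdealTorsion J hKf hK hKJ
    refine exists_fgProjective_resolution _ ?_ fun n => ?_
    · obtain ⟨a, _, _, _⟩ := hKf
      obtain ⟨_, b, _, _⟩ := hN
      exact ⟨b - a, isStrictlyLE_homComplex a b⟩
    · have := isArtinian_homology_homComplex hKf hK hA n
      have := isNoetherian_of_isArtinian_of_pow_smul_eq_zero J k
        fun s hs (x : (homComplex K N).homology n) => smul_eq_zero_of_mem_nullIdeal (hk hs) n x
      infer_instance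
  · intro h
    obtain ⟨t, ht⟩ := IsNoetherian.noetherian J
    have htJ : ∀ s ∈ t.toList, s ∈ J := fun s hs => by
      rw [← ht]
      exact Submodule.subset_span (Finset.mem_toList.1 hs)
    obtain ⟨K, hKf, hK, -, hl, hArt⟩ := exists_koszul t.toList (unitComplex S)
      ⟨0, 0, inferInstance, inferInstance⟩ isTermwiseFGProjective_unitComplex
    have hnull : J ≤ nullIdeal K := by
      rw [← ht, Submodule.span_le]
      exact fun s hs => hl s (Finset.mem_toList.2 hs)
    -- The exponent 1 suffices: null-homotopic elements annihilate the homology of the Koszul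
    -- complex.
    obtain ⟨P, -, hP, hKP⟩ := h K hKf hK fun i s hs x =>
      ⟨1, le_rfl, by rw [pow_one, smul_homology_eq_zero_of_mem_nullIdeal (hnull hs)]⟩
    refine fun n => isArtinian_homology_of_homComplex_unitComplex N n (hArt N ?_ (fun n => ?_) n)
    · intro s hs i x
      obtain ⟨k, -, hk⟩ := hNtors i s (htJ s hs) x
      exact ⟨k, hk⟩
    · refine (isArtinian_iff_isNoetherian_of_smul_eq_zero J fun s hs x =>
        smul_eq_zero_of_mem_nullIdeal (hnull hs) n x).2 ?_
      have := isNoetherian_homology n (hP n).1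
      obtain ⟨i⟩ := hKP.homology_iso n
      exact isNoetherian_of_linearEquiv i.symm.toLinearEquiv
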